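/- For an integer $m\ge 1$ and an integer $k\ge 0$ put $\varphi_k=\cos\left(\frac{(2k+1)\pi}{m}\right)$, and let $\psi(x)=\Gamma'(x)/\Gamma(x)$ $(x>0)$ be the digamma function and $\psi'$ its derivative. Here $\log$ is the natural logarithm, $\sin^{-1}$ is the principal branch of the arcsine, and an empty sum is zero. If $m\ge 2$ is an even integer, then $$\int_0^1 \frac{(x+1)\log(x^{3m}+1)}{x^3+1}\,dx=\frac{m}{12}\left(\psi'(5/6)-\psi'(1/3)\right)-\frac{\pi^2m}{9}-\frac{\pi m\sqrt3}{9}\log 2$$ $$-\frac{2\pi\sqrt3}{9}\left\{2\sum_{k=0}^{\frac m2-1}\log\left[\sin\left(\frac13\sin^{-1}\sqrt{\frac{\varphi_k+1}{2}}\right)\right]-\sum_{k=0}^{\frac m2-1}\log\left[2\cos\left(\frac23\sin^{-1}\sqrt{\frac{1+\varphi_k}{2}}\right)+1\right]-\sum_{k=0}^{\frac m2-1}\log(\varphi_k+1)\right\}.$$ If $m\ge 1$ is an odd integer, then $$\int_0^1 \frac{(x+1)\log(x^{3m}+1)}{x^3+1}\,dx=\frac{m}{12}\left(\psi'(5/6)-\psi'(1/3)\right)-\frac{\pi^2m}{9}+\frac{\pi\sqrt3}{3}\log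 3-\frac{\pi(m-1)\sqrt3}{9}\log 2$$ $$-\frac{2\pi\sqrt3}{9}\left\{2\sum_{k=0}^{\frac{m-3}2}\log\left[\sin\left(\frac13\sin^{-1}\sqrt{\frac{\varphi_k+1}{2}}\right)\right]-\sum_{k=0}^{\frac{m-3}2}\log\left[2\cos\left(\frac23\sin^{-1}\sqrt{\frac{1+\varphi_k}{2}}\right)+1\right]-\sum_{k=0}^{\frac{m-3}2}\log(1+\varphi_k)\right\}.$$ -/

import Mathlib

open scoped BigOperators

noncomputable section

/-- The real digamma function `ψ(x) = Γ'(x) / Γ(x)`. -/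
def psi (x : ℝ) : ℝ := deriv Real.Gamma x / Real.Gamma x

/-- `φ_k = cos((2k+1)π/m)`. -/
def varphi (m k : ℕ) : ℝ := Real.cos ((2 * (k : ℝ) + 1) * Real.pi / (m : ℝ))

end

/-!
Write `κ(x) = (x + 1) / (x³ + 1) = 1 / (x² - x + 1)`. The substitution `x ↦ 1 / x` preserves
`κ(x) dx` and exchanges `(0, 1)` and `(1, ∞)`, so the integral over `(0, 1)` is half of the one over
`(0, ∞)`, up to `(3 m / 2) ∫₀¹ κ(x) log x dx` (`integral_kernel_log_pow_fold`).

The correction term is a trigamma value (`integral_log_kernel`): expanding `1 / (1 + x³)` gives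
the series `S(x) = ∑ 1 / (n + x)²` at `1/6, 1/3, 2/3, 5/6`. Log-convexity of `Γ` gives `S ≤ ψ'`, and
`S(x) + S(1 - x) = ψ'(x) + ψ'(1 - x)` at these points, by splitting `ζ(2)` into residue classes on
the left and by the reflection formula for `Γ` on the right; hence `S = ψ'` there.

For the half-line, factor `(1 + y^m)² = ∏ (y² - 2 y φⱼ + 1)` at `y = x³`, so that everything reduces
to `E(s) = ∫₀^∞ κ(x) log (1 + s³ x³) dx` with `s` on the unit circle. For `0 < s < 1`, partial
fractions and the scaling `x ↦ s x` show that `E'(s)` is `(2 π √3 / 3) (1 + 2 s) / (1 + s + s²)`, so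
`E(s) = (2 π √3 / 3) log (1 + s + s²)`. Both sides are holomorphic in the sector `|arg s| < π / 3`,
so the identity theorem extends the formula to it (`logIntegral_eq`). At `s = exp (i γ / 3)` its
real part is `(2 π √3 / 3) log (1 + 2 cos (γ / 3))` (`integral_kernel_mul_log_quadratic`). The arcsine
expressions are this logarithm written through `sin 3a = sin a (1 + 2 cos 2a)`, with `a = γ / 6`
(`log_sin_arcsin_identity`), and the symmetry `φ_{m-1-j} = φⱼ` halves the sums.
-/

/-! ### The trigamma function at rational points -/

/-- The series `∑ₙ 1 / (n + x)²`, which represents the trigamma function `ψ'(x)`. -/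
noncomputable def invSqSum (x : ℝ) : ℝ := ∑' n : ℕ, 1 / ((n : ℝ) + x) ^ 2

theorem summable_one_div_nat_add_sq {x : ℝ} (hx : 0 < x) :
    Summable fun n : ℕ => 1 / ((n : ℝ) + x) ^ 2 := by
  have h := (Real.summable_one_div_nat_add_rpow x 2).2 (by norm_num)
  refine h.congr fun n => ?_
  rw [abs_of_pos (by positivity)]
  norm_num

/-- The series for `ζ(2)`, split into residue classes modulo `n + 1`. -/
theorem sum_invSqSum_div (n : ℕ) :
    ∑ j ∈ Finset.range (n + 1), invSqSum (((j : ℝ) + 1) / ((n : ℝ) + 1)) =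
      ((n : ℝ) + 1) ^ 2 * (Real.pi ^ 2 / 6) := by
  have hz : ∑' k : ℕ, 1 / ((k : ℝ) + 1) ^ 2 = Real.pi ^ 2 / 6 := by
    rw [← hasSum_zeta_two.tsum_eq, hasSum_zeta_two.summable.tsum_eq_zero_add]
    simp
  have hr := Nat.sumByResidueClasses (summable_one_div_nat_add_sq one_pos) (n + 1)
  rw [hz] at hr
  rw [hr, ← Fin.sum_univ_eq_sum_range
    (fun j : ℕ => invSqSum (((j : ℝ) + 1) / ((n : ℝ) + 1))) (n + 1), Finset.mul_sum]
  refine Finset.sum_congr rfl fun j _ => ?_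
  rw [invSqSum, ← tsum_mul_left]
  refine tsum_congr fun k => ?_
  change _ = ((n : ℝ) + 1) ^ 2 * (1 / ((((j : ℕ) + (n + 1) * k : ℕ) : ℝ) + 1) ^ 2)
  have : (0 : ℝ) < (n : ℝ) + 1 := by positivity
  push_cast
  field_simp
  congr 1
  ring

theorem invSqSum_third_add : invSqSum (1 / 3) + invSqSum (2 / 3) = 4 * Real.pi ^ 2 / 3 := by
  have h0 := sum_invSqSum_div 0
  have h2 := sum_invSqSum_div 2
  norm_num [Finset.sum_range_succ] at h0 h2
  linarith

theorem invSqSum_sixth_add : invSqSum (1 / 6) + invSqSum (5 / 6) = 4 * Real.pi ^ 2 := by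
  have h0 := sum_invSqSum_div 0
  have h1 := sum_invSqSum_div 1
  have h2 := sum_invSqSum_div 2
  have h5 := sum_invSqSum_div 5
  norm_num [Finset.sum_range_succ] at h0 h1 h2 h5
  linarith

theorem Complex.differentiableAt_Gamma_of_re_pos {z : ℂ} (hz : 0 < z.re) :
    DifferentiableAt ℂ Complex.Gamma z :=
  Complex.differentiableAt_Gamma z fun m h => by
    rw [h] at hz
    simp at hz
    linarith [(Nat.cast_nonneg m : (0 : ℝ) ≤ m)]

theorem psi_eq_re {x : ℝ} (hx : 0 < x) :
    psi x = (deriv Complex.Gamma x / Complex.Gamma x).re := by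
  have h := (Complex.differentiableAt_Gamma_of_re_pos (z := x) (by simpa)).hasDerivAt
  have h1 : deriv Real.Gamma x = (deriv Complex.Gamma x).re := h.real_of_complex.deriv
  rw [psi, h1, Complex.Gamma_ofReal, Complex.div_ofReal_re]

theorem differentiableAt_psi {x : ℝ} (hx : 0 < x) : DifferentiableAt ℝ psi x := by
  have hU : IsOpen {z : ℂ | 0 < z.re} := isOpen_lt continuous_const Complex.continuous_re
  have hd : DifferentiableOn ℂ Complex.Gamma {z : ℂ | 0 < z.re} := fun z hz =>
    (Complex.differentiableAt_Gamma_of_re_pos hz).differentiableWithinAt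
  have hx' : (x : ℂ) ∈ {z : ℂ | 0 < z.re} := by simpa
  have h1 : DifferentiableAt ℂ (deriv Complex.Gamma) x :=
    (hd.deriv hU).differentiableAt (hU.mem_nhds hx')
  have h2 := (h1.div (Complex.differentiableAt_Gamma_of_re_pos hx')
    (Complex.Gamma_ne_zero_of_re_pos hx')).hasDerivAt.real_of_complex.differentiableAt
  refine h2.congr_of_eventuallyEq ?_
  filter_upwards [lt_mem_nhds hx] with y hy
  exact psi_eq_re hy

theorem Real.differentiableAt_Gamma_of_pos {x : ℝ} (hx : 0 < x) :
    DifferentiableAt ℝ Real.Gamma x :=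
  Real.differentiableAt_Gamma fun m h => by
    have : (0 : ℝ) ≤ m := by positivity
    linarith

theorem deriv_log_Gamma {x : ℝ} (hx : 0 < x) : deriv (Real.log ∘ Real.Gamma) x = psi x :=
  ((Real.differentiableAt_Gamma_of_pos hx).hasDerivAt.log (Real.Gamma_pos_of_pos hx).ne').deriv

/-- The function `ψ` is the derivative of the convex function `log Γ`. -/
theorem deriv_psi_nonneg {x : ℝ} (hx : 0 < x) : 0 ≤ deriv psi x := by
  have hm : MonotoneOn psi (Set.Ioi 0) := by
    have := Real.convexOn_log_Gamma.monotoneOn_deriv fun y hy =>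
      ((Real.differentiableAt_Gamma_of_pos hy).log
        (Real.Gamma_pos_of_pos hy).ne')
    exact this.congr fun y hy => deriv_log_Gamma hy
  rw [← derivWithin_of_isOpen isOpen_Ioi (Set.mem_Ioi.2 hx)]
  exact hm.derivWithin_nonneg

theorem psi_add_one {x : ℝ} (hx : 0 < x) : psi (x + 1) = psi x + 1 / x := by
  have hG := Real.Gamma_pos_of_pos hx
  have h1 : HasDerivAt (fun y => Real.Gamma (y + 1)) (deriv Real.Gamma (x + 1)) x :=
    (Real.differentiableAt_Gamma_of_pos (by positivity)).hasDerivAt.comp_add_const x 1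
  have h2 : HasDerivAt (fun y => y * Real.Gamma y)
      (1 * Real.Gamma x + x * deriv Real.Gamma x) x :=
    (hasDerivAt_id x).mul (Real.differentiableAt_Gamma_of_pos hx).hasDerivAt
  have h3 : (fun y => Real.Gamma (y + 1)) =ᶠ[nhds x] fun y => y * Real.Gamma y := by
    filter_upwards [lt_mem_nhds hx] with y hy
    exact Real.Gamma_add_one hy.ne'
  rw [psi, psi, h1.unique (h2.congr_of_eventuallyEq h3), Real.Gamma_add_one hx.ne']
  field_simp
  ring

theorem deriv_psi_eq_add {x : ℝ} (hx : 0 < x) :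
    deriv psi x = 1 / x ^ 2 + deriv psi (x + 1) := by
  have h1 : HasDerivAt (fun y => psi (y + 1)) (deriv psi (x + 1)) x :=
    (differentiableAt_psi (by positivity)).hasDerivAt.comp_add_const x 1
  have h2 : HasDerivAt (fun y => psi y + y⁻¹) (deriv psi x + -(x ^ 2)⁻¹) x :=
    (differentiableAt_psi hx).hasDerivAt.add (hasDerivAt_inv hx.ne')
  have h3 : (fun y => psi (y + 1)) =ᶠ[nhds x] fun y => psi y + y⁻¹ := by
    filter_upwards [lt_mem_nhds hx] with y hy
    rw [psi_add_one hy, one_div]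
  rw [h1.unique (h2.congr_of_eventuallyEq h3)]
  ring

/-- Iterating `ψ'(x) = 1 / x² + ψ'(x + 1)` leaves a nonnegative remainder `ψ'(x + N)`. -/
theorem invSqSum_le_deriv_psi {x : ℝ} (hx : 0 < x) : invSqSum x ≤ deriv psi x := by
  have key : ∀ N : ℕ, deriv psi x =
      (∑ n ∈ Finset.range N, 1 / ((n : ℝ) + x) ^ 2) + deriv psi ((N : ℝ) + x) := by
    intro N
    induction N with
    | zero => simp
    | succ N ih =>
      rw [Finset.sum_range_succ, ih, deriv_psi_eq_add (x := (N : ℝ) + x) (by positivity)]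
      push_cast
      rw [add_right_comm (N : ℝ) x 1, add_assoc (∑ n ∈ _, _)]
  refine (summable_one_div_nat_add_sq hx).tsum_le_of_sum_range_le fun N => ?_
  rw [key N]
  exact le_add_of_nonneg_right (deriv_psi_nonneg (by positivity))

/-- Two differentiations of the logarithm of `Γ(x) Γ(1 - x) = π / sin (π x)`. -/
theorem deriv_psi_reflection {x : ℝ} (h0 : 0 < x) (h1 : x < 1) :
    deriv psi x + deriv psi (1 - x) = (Real.pi / Real.sin (Real.pi * x)) ^ 2 := by
  have hsin : ∀ {y : ℝ}, 0 < y → y < 1 → 0 < Real.sin (Real.pi * y) := fun hy0 hy1 =>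
    Real.sin_pos_of_pos_of_lt_pi (by positivity) (by nlinarith [Real.pi_pos])
  have hlin : ∀ y : ℝ, HasDerivAt (fun y => Real.pi * y) Real.pi y := fun y => by
    simpa using (hasDerivAt_id y).const_mul Real.pi
  have hfirst : ∀ {y : ℝ}, 0 < y → y < 1 →
      psi y - psi (1 - y) =
        -(Real.pi * Real.cos (Real.pi * y) / Real.sin (Real.pi * y)) := by
    intro y hy0 hy1
    have hy1' : 0 < 1 - y := by linarith
    have hs := hsin hy0 hy1
    have hG := Real.Gamma_pos_of_pos hy0
    have hG' := Real.Gamma_pos_of_pos hy1'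
    have hA : HasDerivAt (fun y => Real.Gamma y * Real.Gamma (1 - y))
        (deriv Real.Gamma y * Real.Gamma (1 - y) +
          Real.Gamma y * -deriv Real.Gamma (1 - y)) y :=
      (Real.differentiableAt_Gamma_of_pos hy0).hasDerivAt.mul
        ((Real.differentiableAt_Gamma_of_pos hy1').hasDerivAt.comp_const_sub 1 y)
    have hB : HasDerivAt (fun y => Real.pi / Real.sin (Real.pi * y)) _ y :=
      (hasDerivAt_const y Real.pi).div ((hlin y).sin) hs.ne'
    have hE : (fun y => Real.Gamma y * Real.Gamma (1 - y)) =
        fun y => Real.pi / Real.sin (Real.pi * y) :=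
      funext fun y => Real.Gamma_mul_Gamma_one_sub y
    rw [hE] at hA
    have h := hA.unique hB
    have hprod := Real.Gamma_mul_Gamma_one_sub y
    have hl : psi y - psi (1 - y) = (deriv Real.Gamma y * Real.Gamma (1 - y) +
          Real.Gamma y * -deriv Real.Gamma (1 - y)) /
          (Real.Gamma y * Real.Gamma (1 - y)) := by
      rw [psi, psi]
      field_simp
      ring
    rw [hl, h, hprod]
    have := Real.pi_pos
    field_simp
    ring
  have hs := hsin h0 h1
  have hA : HasDerivAt (fun y => psi y - psi (1 - y)) (deriv psi x - -deriv psi (1 - x)) x :=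
    (differentiableAt_psi h0).hasDerivAt.sub
      ((differentiableAt_psi (by linarith)).hasDerivAt.comp_const_sub 1 x)
  have hB : HasDerivAt
      (fun y => -(Real.pi * Real.cos (Real.pi * y) / Real.sin (Real.pi * y))) _ x :=
    ((((hlin x).cos).const_mul Real.pi).div ((hlin x).sin) hs.ne').neg
  have hE : (fun y => psi y - psi (1 - y)) =ᶠ[nhds x]
      fun y => -(Real.pi * Real.cos (Real.pi * y) / Real.sin (Real.pi * y)) := by
    filter_upwards [lt_mem_nhds h0, gt_mem_nhds h1] with y hy0 hy1
    exact hfirst hy0 hy1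
  have h := hA.unique (hB.congr_of_eventuallyEq hE)
  rw [sub_neg_eq_add] at h
  rw [h]
  field_simp
  linear_combination (Real.sin_sq_add_cos_sq (Real.pi * x))

theorem deriv_psi_sixth_add : deriv psi (1 / 6) + deriv psi (5 / 6) = 4 * Real.pi ^ 2 := by
  have h := deriv_psi_reflection (x := 1 / 6) (by norm_num) (by norm_num)
  rw [show Real.pi * (1 / 6) = Real.pi / 6 by ring, Real.sin_pi_div_six] at h
  norm_num at h
  rw [h]
  ring

theorem deriv_psi_third_add : deriv psi (1 / 3) + deriv psi (2 / 3) = 4 * Real.pi ^ 2 / 3 := by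
  have h := deriv_psi_reflection (x := 1 / 3) (by norm_num) (by norm_num)
  rw [show Real.pi * (1 / 3) = Real.pi / 3 by ring, Real.sin_pi_div_three, div_pow, div_pow,
    Real.sq_sqrt (by norm_num)] at h
  norm_num at h
  rw [h]
  ring

/-- The inequality `∑ₙ 1 / (n + x)² ≤ ψ'(x)` holds at `5/6` and at `1/6`; as both sides have the
same sum over these two points, it is an equality. -/
theorem invSqSum_five_sixths : invSqSum (5 / 6) = deriv psi (5 / 6) := by
  have h1 := invSqSum_le_deriv_psi (x := 1 / 6) (by norm_num)
  have h2 := invSqSum_le_deriv_psi (x := 5 / 6) (by norm_num)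
  linarith [invSqSum_sixth_add, deriv_psi_sixth_add]

theorem invSqSum_third : invSqSum (1 / 3) = deriv psi (1 / 3) := by
  have h1 := invSqSum_le_deriv_psi (x := 1 / 3) (by norm_num)
  have h2 := invSqSum_le_deriv_psi (x := 2 / 3) (by norm_num)
  linarith [invSqSum_third_add, deriv_psi_third_add]

/-! ### The integral of `log x / (x² - x + 1)` over the unit interval -/

/-- The weight `1 / (x² - x + 1) = (x + 1) / (x³ + 1)`. -/
noncomputable def kernel (x : ℝ) : ℝ := 1 / (x ^ 2 - x + 1)

theorem kernel_denom_pos (x : ℝ) : 0 < x ^ 2 - x + 1 := by nlinarith [sq_nonneg (2 * x - 1)]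

theorem intervalIntegrable_mul_log {f : ℝ → ℝ} (hf : Continuous f) (a b : ℝ) :
    IntervalIntegrable (fun x => f x * Real.log x) MeasureTheory.volume a b :=
  intervalIntegral.intervalIntegrable_log'.continuousOn_mul hf.continuousOn

theorem integral_pow_mul_log (k : ℕ) :
    ∫ x in (0 : ℝ)..1, x ^ k * Real.log x = -(1 / ((k : ℝ) + 1) ^ 2) := by
  have hk : (0 : ℝ) < (k : ℝ) + 1 := by positivity
  have h := intervalIntegral.integral_eq_sub_of_hasDerivAt_of_le (a := 0) (b := 1)
    (f := fun x : ℝ => x ^ k * (x * Real.log x) / (k + 1) - x ^ (k + 1) / ((k : ℝ) + 1) ^ 2)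
    (f' := fun x => x ^ k * Real.log x) zero_le_one
    (by
      have := Real.continuous_mul_log
      fun_prop)
    (fun x hx => by
      have h1 : HasDerivAt (fun x : ℝ => x ^ (k + 1)) (((k : ℝ) + 1) * x ^ k) x := by
        simpa using hasDerivAt_pow (k + 1) x
      have h2 := ((h1.mul (Real.hasDerivAt_log hx.1.ne')).div_const ((k : ℝ) + 1)).sub
        (h1.div_const (((k : ℝ) + 1) ^ 2))
      have hx0 := hx.1.ne'
      refine (h2.congr_of_eventuallyEq (Filter.Eventually.of_forall fun y => ?_)).congr_deriv ?_
      · simp only [Pi.mul_apply, Pi.sub_apply]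
        ring
      · field_simp
        ring)
    (intervalIntegrable_mul_log (by fun_prop) 0 1)
  rw [h]
  simp

theorem continuous_kernel : Continuous kernel :=
  continuous_const.div (by fun_prop) fun x => (kernel_denom_pos x).ne'

theorem kernel_pos (x : ℝ) : 0 < kernel x := div_pos one_pos (kernel_denom_pos x)

theorem kernel_le_two (x : ℝ) : kernel x ≤ 2 := by
  rw [kernel, div_le_iff₀ (kernel_denom_pos x)]
  nlinarith [sq_nonneg (2 * x - 1)]

/-- The partial sums come from `1 / (1 + x³) = ∑_{n < N} x⁶ⁿ (1 - x³) + x⁶ᴺ / (1 + x³)`, multiplied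
by `1 + x`. -/
theorem integral_log_kernel_eq_partial (N : ℕ) :
    ∫ x in (0 : ℝ)..1, kernel x * Real.log x =
      (∑ n ∈ Finset.range N, (-(1 / (6 * (n : ℝ) + 1) ^ 2) - 1 / (6 * (n : ℝ) + 2) ^ 2
        + 1 / (6 * (n : ℝ) + 4) ^ 2 + 1 / (6 * (n : ℝ) + 5) ^ 2)) +
      ∫ x in (0 : ℝ)..1, x ^ (6 * N) * kernel x * Real.log x := by
  have hk := continuous_kernel
  induction N with
  | zero => simp
  | succ N ih =>
    rw [ih, Finset.sum_range_succ, add_assoc]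
    congr 1
    have hsplit : ∀ x : ℝ, x ^ (6 * N) * kernel x * Real.log x =
        (x ^ (6 * N) * Real.log x + x ^ (6 * N + 1) * Real.log x
          - x ^ (6 * N + 3) * Real.log x - x ^ (6 * N + 4) * Real.log x) +
        x ^ (6 * (N + 1)) * kernel x * Real.log x := by
      intro x
      have hq : (x ^ 2 - x + 1) * kernel x = 1 := mul_one_div_cancel (kernel_denom_pos x).ne'
      have hgeom : kernel x =
          (1 + x) * (1 - x ^ 3) + x ^ 6 * kernel x := by
        linear_combination (1 + x) * (1 - x ^ 3) * hq
      linear_combination (x ^ (6 * N) * Real.log x) * hgeom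
    have hi : ∀ k : ℕ, IntervalIntegrable (fun x : ℝ => x ^ k * Real.log x)
        MeasureTheory.volume 0 1 := fun k => intervalIntegrable_mul_log (by fun_prop) 0 1
    simp_rw [hsplit]
    rw [intervalIntegral.integral_add ((((hi _).add (hi _)).sub (hi _)).sub (hi _))
        (intervalIntegrable_mul_log (by fun_prop) 0 1),
      intervalIntegral.integral_sub (((hi _).add (hi _)).sub (hi _)) (hi _),
      intervalIntegral.integral_sub ((hi _).add (hi _)) (hi _),
      intervalIntegral.integral_add (hi _) (hi _)]
    simp_rw [integral_pow_mul_log]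
    push_cast
    ring

theorem abs_integral_pow_kernel_log_le (k : ℕ) :
    |∫ x in (0 : ℝ)..1, x ^ k * kernel x * Real.log x| ≤
      2 * (1 / ((k : ℝ) + 1) ^ 2) := by
  have h : ‖∫ x in (0 : ℝ)..1, x ^ k * kernel x * Real.log x‖ ≤
      ∫ x in (0 : ℝ)..1, -2 * (x ^ k * Real.log x) := by
    refine intervalIntegral.norm_integral_le_of_norm_le zero_le_one
      (MeasureTheory.ae_of_all _ fun x hx => ?_)
      ((intervalIntegrable_mul_log (by fun_prop) 0 1).const_mul _)
    have hl : Real.log x ≤ 0 := Real.log_nonpos hx.1.le hx.2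
    have hp : 0 ≤ x ^ k := pow_nonneg hx.1.le k
    have hq := kernel_pos x
    rw [Real.norm_eq_abs, abs_mul, abs_of_nonpos hl, abs_of_nonneg (by positivity)]
    nlinarith [mul_nonneg hp (neg_nonneg.2 hl), kernel_le_two x]
  rw [intervalIntegral.integral_const_mul, integral_pow_mul_log] at h
  rw [← Real.norm_eq_abs]
  linarith

theorem integral_log_kernel :
    ∫ x in (0 : ℝ)..1, kernel x * Real.log x =
      (deriv psi (5 / 6) - deriv psi (1 / 3)) / 18 - 2 * Real.pi ^ 2 / 27 := by
  have hs : ∀ {x : ℝ}, 0 < x → HasSum (fun n : ℕ => 1 / ((n : ℝ) + x) ^ 2) (invSqSum x) :=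
    fun hx => (summable_one_div_nat_add_sq hx).hasSum
  have hsum := ((((hs (x := 1 / 6) (by norm_num)).neg.sub (hs (x := 1 / 3) (by norm_num))).add
    (hs (x := 2 / 3) (by norm_num))).add (hs (x := 5 / 6) (by norm_num))).mul_left (1 / 36)
  have hlim := hsum.tendsto_sum_nat
  have hrem : Filter.Tendsto (fun N : ℕ =>
      ∫ x in (0 : ℝ)..1, x ^ (6 * N) * kernel x * Real.log x)
      Filter.atTop (nhds 0) := by
    refine squeeze_zero_norm (a := fun N : ℕ => 2 * (1 / ((N : ℝ) + 1))) (fun N => ?_) ?_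
    · refine (abs_integral_pow_kernel_log_le (6 * N)).trans ?_
      have hN : (0 : ℝ) ≤ N := Nat.cast_nonneg N
      push_cast
      gcongr
      nlinarith
    · simpa using (tendsto_one_div_add_atTop_nhds_zero_nat (𝕜 := ℝ)).const_mul 2
  have htot : Filter.Tendsto
      (fun _ : ℕ => ∫ x in (0 : ℝ)..1, kernel x * Real.log x) Filter.atTop _ :=
    (hlim.add hrem).congr fun N => by
    rw [integral_log_kernel_eq_partial N]
    congr 1
    refine Finset.sum_congr rfl fun n _ => ?_
    have : (0 : ℝ) ≤ n := Nat.cast_nonneg n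
    field_simp
    ring
  rw [tendsto_nhds_unique tendsto_const_nhds htot, invSqSum_five_sixths, invSqSum_third]
  linarith [invSqSum_third_add, invSqSum_sixth_add, invSqSum_five_sixths, invSqSum_third]

/-! ### Integrals over the half-line against the kernel -/

theorem kernel_eq_div {x : ℝ} (hx : 0 < x) : kernel x = (x + 1) / (x ^ 3 + 1) := by
  have := kernel_denom_pos x
  rw [kernel, div_eq_div_iff this.ne' (by positivity)]
  ring

theorem kernel_le_rpow {x : ℝ} (hx : 0 < x) : kernel x ≤ 4 * (x + 1) ^ (-2 : ℝ) := by
  rw [Real.rpow_neg (by positivity), kernel, ← div_eq_mul_inv,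
    div_le_div_iff₀ (kernel_denom_pos x) (by positivity)]
  norm_cast
  nlinarith [sq_nonneg (x - 1)]

theorem integrableOn_kernel_smul {E : Type*} [NormedAddCommGroup E] [NormedSpace ℝ E]
    {f : ℝ → E} {C : ℝ} (hf : ContinuousOn f (Set.Ioi 0))
    (h : ∀ x, 0 < x → ‖f x‖ ≤ C * (x + 1) ^ (1 / 2 : ℝ)) :
    MeasureTheory.IntegrableOn (fun x => kernel x • f x) (Set.Ioi 0) := by
  have hb := ((integrableOn_add_rpow_Ioi_of_lt (a := -(3 / 2)) (c := 0) (m := 1)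
    (by norm_num) (by norm_num)).const_mul (4 * C))
  refine MeasureTheory.Integrable.mono' hb
    ((continuous_kernel.continuousOn.smul hf).aestronglyMeasurable measurableSet_Ioi) ?_
  filter_upwards [MeasureTheory.ae_restrict_mem measurableSet_Ioi] with x hx
  have hx : 0 < x := hx
  have hp : (x + 1) ^ (-(3 / 2) : ℝ) = (x + 1) ^ (-2 : ℝ) * (x + 1) ^ (1 / 2 : ℝ) := by
    rw [← Real.rpow_add (by positivity)]
    norm_num
  rw [norm_smul, Real.norm_eq_abs, abs_of_pos (kernel_pos x), hp]
  calc kernel x * ‖f x‖ ≤ (4 * (x + 1) ^ (-2 : ℝ)) * (C * (x + 1) ^ (1 / 2 : ℝ)) :=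
        mul_le_mul (kernel_le_rpow hx) (h x hx) (norm_nonneg _) (by positivity)
    _ = _ := by ring

theorem integrableOn_kernel_smul_of_bounded {E : Type*} [NormedAddCommGroup E] [NormedSpace ℝ E]
    {f : ℝ → E} {C : ℝ} (hf : ContinuousOn f (Set.Ioi 0)) (h : ∀ x, 0 < x → ‖f x‖ ≤ C) :
    MeasureTheory.IntegrableOn (fun x => kernel x • f x) (Set.Ioi 0) := by
  refine integrableOn_kernel_smul (C := C) hf fun x hx => (h x hx).trans ?_
  exact le_mul_of_one_le_right ((norm_nonneg _).trans (h x hx))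
    (Real.one_le_rpow (by linarith) (by norm_num))

theorem integral_Ioi_inversion {E : Type*} [NormedAddCommGroup E] [NormedSpace ℝ E]
    (f : ℝ → E) :
    ∫ x in Set.Ioi (0 : ℝ), (x ^ 2)⁻¹ • f x⁻¹ = ∫ x in Set.Ioi (0 : ℝ), f x := by
  rw [← MeasureTheory.integral_comp_rpow_Ioi f (p := -1) (by norm_num)]
  refine MeasureTheory.setIntegral_congr_fun measurableSet_Ioi fun x hx => ?_
  have hx : 0 < x := hx
  have h2 : x ^ (-1 - 1 : ℝ) = (x ^ 2)⁻¹ := by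
    rw [show (-1 - 1 : ℝ) = -((2 : ℕ) : ℝ) by norm_num, Real.rpow_neg hx.le, Real.rpow_natCast]
  simp [Real.rpow_neg_one, h2]

theorem inv_sq_mul_kernel_inv {x : ℝ} (hx : 0 < x) : (x ^ 2)⁻¹ * kernel x⁻¹ = kernel x := by
  have h := kernel_denom_pos x
  have h' := kernel_denom_pos x⁻¹
  rw [kernel, kernel, ← one_div, div_mul_div_comm,
    div_eq_div_iff (by positivity) h.ne']
  field_simp
  ring

theorem integral_kernel : ∫ x in Set.Ioi (0 : ℝ), kernel x = 4 * Real.pi * √3 / 9 := by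
  have h3 : (√3 : ℝ) ^ 2 = 3 := Real.sq_sqrt (by norm_num)
  have h3p : 0 < (√3 : ℝ) := by positivity
  have hd : ∀ x : ℝ, HasDerivAt (fun x => 2 / √3 * Real.arctan ((2 * x - 1) / √3))
      (kernel x) x := by
    intro x
    have h1 : HasDerivAt (fun x : ℝ => (2 * x - 1) / √3) (2 / √3) x := by
      simpa using (((hasDerivAt_id x).const_mul 2).sub_const 1).div_const (√3)
    refine (h1.arctan.const_mul (2 / √3)).congr_deriv ?_
    have := kernel_denom_pos x
    have hq : 1 + ((2 * x - 1) / √3) ^ 2 = 4 / 3 * (x ^ 2 - x + 1) := by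
      rw [div_pow, h3]
      ring
    rw [hq, kernel]
    field_simp
    rw [h3]
    ring
  have hlim : Filter.Tendsto (fun x => 2 / √3 * Real.arctan ((2 * x - 1) / √3)) Filter.atTop
      (nhds (2 / √3 * (Real.pi / 2))) := by
    refine Filter.Tendsto.const_mul _ ((tendsto_nhds_of_tendsto_nhdsWithin
      Real.tendsto_arctan_atTop).comp ?_)
    refine Filter.Tendsto.atTop_div_const h3p ?_
    exact Filter.tendsto_atTop_add_const_right _ (-1)
      (Filter.tendsto_id.const_mul_atTop (by norm_num : (0 : ℝ) < 2))
  rw [MeasureTheory.integral_Ioi_of_hasDerivAt_of_nonneg' (fun x _ => hd x)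
    (fun x _ => (kernel_pos x).le) hlim]
  have h0 : Real.arctan ((2 * 0 - 1) / √3) = -(Real.pi / 6) := by
    rw [← Real.arctan_inv_sqrt_three, ← Real.arctan_neg]
    congr 1
    ring
  rw [h0]
  field_simp
  rw [h3]
  ring

theorem integrableOn_inv_one_add_cube :
    MeasureTheory.IntegrableOn (fun x : ℝ => 1 / (1 + x ^ 3)) (Set.Ioi 0) := by
  refine (integrableOn_kernel_smul_of_bounded (f := fun x : ℝ => 1 / (x + 1)) (C := 1)
    (fun x hx => ContinuousAt.continuousWithinAt (by
      have hx : 0 < x := hx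
      fun_prop (disch := positivity))) fun x hx => ?_).congr_fun (fun x hx => ?_) measurableSet_Ioi
  · rw [Real.norm_eq_abs, abs_of_pos (by positivity), div_le_one (by positivity)]
    linarith
  · have hx : 0 < x := hx
    simp only [smul_eq_mul, kernel_eq_div hx]
    field_simp
    ring

theorem integrableOn_self_div_one_add_cube :
    MeasureTheory.IntegrableOn (fun x : ℝ => x / (1 + x ^ 3)) (Set.Ioi 0) := by
  refine (integrableOn_kernel_smul_of_bounded (f := fun x : ℝ => x / (x + 1)) (C := 1)
    (fun x hx => ContinuousAt.continuousWithinAt (by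
      have hx : 0 < x := hx
      fun_prop (disch := positivity))) fun x hx => ?_).congr_fun (fun x hx => ?_) measurableSet_Ioi
  · rw [Real.norm_eq_abs, abs_of_pos (by positivity), div_le_one (by positivity)]
    linarith
  · have hx : 0 < x := hx
    simp only [smul_eq_mul, kernel_eq_div hx]
    field_simp
    ring

/-- The inversion `x ↦ 1 / x` exchanges the two integrands, and their sum is the kernel. -/
theorem integral_one_add_cube :
    ∫ x in Set.Ioi (0 : ℝ), 1 / (1 + x ^ 3) = 2 * Real.pi * √3 / 9 ∧
    ∫ x in Set.Ioi (0 : ℝ), x / (1 + x ^ 3) = 2 * Real.pi * √3 / 9 := by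
  have hinv : ∫ x in Set.Ioi (0 : ℝ), x / (1 + x ^ 3) =
      ∫ x in Set.Ioi (0 : ℝ), 1 / (1 + x ^ 3) := by
    rw [← integral_Ioi_inversion fun x : ℝ => 1 / (1 + x ^ 3)]
    refine MeasureTheory.setIntegral_congr_fun measurableSet_Ioi fun x hx => ?_
    have hx : 0 < x := hx
    simp only [smul_eq_mul]
    field_simp
    ring
  have hsum : (∫ x in Set.Ioi (0 : ℝ), 1 / (1 + x ^ 3)) +
      ∫ x in Set.Ioi (0 : ℝ), x / (1 + x ^ 3) = 4 * Real.pi * √3 / 9 := by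
    rw [← MeasureTheory.integral_add integrableOn_inv_one_add_cube
      integrableOn_self_div_one_add_cube, ← integral_kernel]
    refine MeasureTheory.setIntegral_congr_fun measurableSet_Ioi fun x hx => ?_
    have hx : 0 < x := hx
    simp only [kernel_eq_div hx]
    field_simp
    ring
  constructor <;> linarith

/-- Partial fractions in `x³`: after multiplication by `1 - t³` the integrand is a combination of
`(1 + x) / (1 + (t x)³)`, which scales to `integral_one_add_cube`, and the kernel. -/
theorem integral_kernel_mul_cube_div {t : ℝ} (h0 : 0 < t) (h1 : t < 1) :
    ∫ x in Set.Ioi (0 : ℝ), kernel x * (3 * t ^ 2 * x ^ 3 / (1 + t ^ 3 * x ^ 3)) =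
      2 * Real.pi * √3 / 3 * ((1 + 2 * t) / (1 + t + t ^ 2)) := by
  have ht : 0 < 1 - t := by linarith
  have ht3 : 1 - t ^ 3 = (1 - t) * (1 + t + t ^ 2) := by ring
  have ht3p : 0 < 1 - t ^ 3 := by
    rw [ht3]
    positivity
  have hi1 : MeasureTheory.IntegrableOn (fun x : ℝ => 1 / (1 + (t * x) ^ 3)) (Set.Ioi 0) := by
    refine (MeasureTheory.integrableOn_Ioi_comp_mul_left_iff (fun x : ℝ => 1 / (1 + x ^ 3)) 0
      h0).2 ?_
    simpa using integrableOn_inv_one_add_cube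
  have hi2 : MeasureTheory.IntegrableOn (fun x : ℝ => (t * x) / (1 + (t * x) ^ 3))
      (Set.Ioi 0) := by
    refine (MeasureTheory.integrableOn_Ioi_comp_mul_left_iff (fun x : ℝ => x / (1 + x ^ 3)) 0
      h0).2 ?_
    simpa using integrableOn_self_div_one_add_cube
  have hik : MeasureTheory.IntegrableOn kernel (Set.Ioi 0) := by
    simpa using integrableOn_kernel_smul_of_bounded (f := fun _ : ℝ => (1 : ℝ)) (C := 1)
      continuousOn_const (by simp)
  have hI1 : ∫ x in Set.Ioi (0 : ℝ), 1 / (1 + (t * x) ^ 3) = t⁻¹ * (2 * Real.pi * √3 / 9) := by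
    rw [MeasureTheory.integral_comp_mul_left_Ioi (fun x : ℝ => 1 / (1 + x ^ 3)) 0 h0, mul_zero,
      integral_one_add_cube.1, smul_eq_mul]
  have hI2 : ∫ x in Set.Ioi (0 : ℝ), (t * x) / (1 + (t * x) ^ 3) =
      t⁻¹ * (2 * Real.pi * √3 / 9) := by
    rw [MeasureTheory.integral_comp_mul_left_Ioi (fun x : ℝ => x / (1 + x ^ 3)) 0 h0, mul_zero,
      integral_one_add_cube.2, smul_eq_mul]
  have hpf : ∀ x ∈ Set.Ioi (0 : ℝ), kernel x * (3 * t ^ 2 * x ^ 3 / (1 + t ^ 3 * x ^ 3)) =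
      3 * t ^ 2 / (1 - t ^ 3) * ((1 / (1 + (t * x) ^ 3) +
        t⁻¹ * ((t * x) / (1 + (t * x) ^ 3))) - kernel x) := by
    intro x hx
    have hx : 0 < x := hx
    rw [kernel_eq_div hx, mul_pow]
    field_simp
    ring
  have hi3 : MeasureTheory.IntegrableOn
      (fun x : ℝ => 1 / (1 + (t * x) ^ 3) + t⁻¹ * ((t * x) / (1 + (t * x) ^ 3))) (Set.Ioi 0) :=
    hi1.add (hi2.const_mul _)
  rw [MeasureTheory.setIntegral_congr_fun measurableSet_Ioi hpf,
    MeasureTheory.integral_const_mul,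
    MeasureTheory.integral_sub hi3 hik,
    MeasureTheory.integral_add hi1 (hi2.const_mul _), MeasureTheory.integral_const_mul, hI1, hI2,
    integral_kernel, ht3]
  field_simp
  ring

/-! ### The logarithmic integral on a sector -/

/-- The open sector `|arg s| < π / 3`. -/
def cubeSector : Set ℂ := {s | |s.im| < √3 * s.re}

theorem isOpen_cubeSector : IsOpen cubeSector := by
  unfold cubeSector
  exact isOpen_lt (by fun_prop) (by fun_prop)

theorem convex_cubeSector : Convex ℝ cubeSector := by
  intro x hx y hy a b ha hb hab
  have hx : |x.im| < √3 * x.re := hx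
  have hy : |y.im| < √3 * y.re := hy
  change |(a • x + b • y).im| < √3 * (a • x + b • y).re
  simp only [Complex.add_im, Complex.add_re, Complex.smul_im, Complex.smul_re, smul_eq_mul]
  rw [abs_lt] at *
  rcases ha.eq_or_lt with rfl | ha'
  · obtain rfl : b = 1 := by linarith
    constructor <;> linarith
  · constructor <;>
      nlinarith [mul_lt_mul_of_pos_left hx.1 ha', mul_lt_mul_of_pos_left hx.2 ha',
        mul_le_mul_of_nonneg_left hy.1.le hb, mul_le_mul_of_nonneg_left hy.2.le hb]

theorem re_pos_of_mem_cubeSector {s : ℂ} (hs : s ∈ cubeSector) : 0 < s.re := by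
  have h : |s.im| < √3 * s.re := hs
  have h3 : 0 < (√3 : ℝ) := by positivity
  exact pos_of_mul_pos_right ((abs_nonneg _).trans_lt h) h3.le

theorem ofReal_mem_cubeSector {t : ℝ} (ht : 0 < t) : (t : ℂ) ∈ cubeSector := by
  change |(t : ℂ).im| < √3 * (t : ℂ).re
  simpa using ht

theorem cube_mem_slitPlane {s : ℂ} (hs : s ∈ cubeSector) : s ^ 3 ∈ Complex.slitPlane := by
  have hre := re_pos_of_mem_cubeSector hs
  have h : |s.im| < √3 * s.re := hs
  have hsq : s.im ^ 2 < 3 * s.re ^ 2 := by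
    have := pow_lt_pow_left₀ h (abs_nonneg _) two_ne_zero
    rwa [sq_abs, mul_pow, Real.sq_sqrt (by norm_num)] at this
  have hR : (s ^ 3).re = s.re ^ 3 - 3 * s.re * s.im ^ 2 := by
    simp [pow_succ]
    ring
  have hI : (s ^ 3).im = s.im * (3 * s.re ^ 2 - s.im ^ 2) := by
    simp [pow_succ]
    ring
  rw [Complex.mem_slitPlane_iff, hR, hI]
  by_cases him : s.im = 0
  · left
    rw [him]
    simpa using pow_pos hre 3
  · right
    exact mul_ne_zero him (by linarith)

theorem one_add_mul_mem_slitPlane {c : ℂ} (hc : c ∈ Complex.slitPlane) {y : ℝ} (hy : 0 ≤ y) :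
    1 + c * y ∈ Complex.slitPlane := by
  rw [Complex.mem_slitPlane_iff] at *
  rcases hc with h | h
  · left
    simp
    positivity
  · rcases hy.eq_or_lt with rfl | hy'
    · simp
    · right
      simpa using ⟨h, hy'.ne'⟩

theorem one_add_add_sq_mem_slitPlane {s : ℂ} (hs : 0 < s.re) :
    1 + s + s ^ 2 ∈ Complex.slitPlane := by
  have hR : (1 + s + s ^ 2).re = 1 + s.re + s.re ^ 2 - s.im ^ 2 := by
    simp [pow_succ]
    ring
  have hI : (1 + s + s ^ 2).im = s.im * (1 + 2 * s.re) := by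
    simp [pow_succ]
    ring
  rw [Complex.mem_slitPlane_iff, hR, hI]
  by_cases him : s.im = 0
  · left
    rw [him]
    simp
    positivity
  · right
    exact mul_ne_zero him (by positivity)

theorem norm_add_re_pos {c : ℂ} (hc : c ∈ Complex.slitPlane) : 0 < ‖c‖ + c.re := by
  rcases Complex.mem_slitPlane_iff.1 hc with h | h
  · linarith [norm_nonneg c]
  · have := Complex.abs_re_lt_norm.2 h
    linarith [neg_abs_le c.re]

/-- The factor by which `‖1 + c y‖` may fall short of `1 + ‖c‖ y`, uniformly in `y ≥ 0`. -/
noncomputable def slitFactor (c : ℂ) : ℝ := √(2 * ‖c‖ / (‖c‖ + c.re))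

/-- With `r = ‖c‖` and `a = re c`, twice `r ‖1 + c y‖²` is
`(r - a) (1 - r y)² + (r + a) (1 + r y)²`. -/
theorem one_add_norm_mul_le {c : ℂ} (hc : c ∈ Complex.slitPlane) {y : ℝ} (hy : 0 ≤ y) :
    1 + ‖c‖ * y ≤ slitFactor c * ‖1 + c * y‖ := by
  have hp := norm_add_re_pos hc
  have hn : ‖1 + c * y‖ ^ 2 = 1 + 2 * y * c.re + ‖c‖ ^ 2 * y ^ 2 := by
    rw [← Complex.normSq_eq_norm_sq, ← Complex.normSq_eq_norm_sq, Complex.normSq_apply,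
      Complex.normSq_apply]
    simp
    ring
  have hr : c.re ≤ ‖c‖ := Complex.re_le_norm c
  have hf : slitFactor c ^ 2 = 2 * ‖c‖ / (‖c‖ + c.re) := Real.sq_sqrt (by positivity)
  refine (pow_le_pow_iff_left₀ (by positivity) (by unfold slitFactor; positivity) two_ne_zero).1 ?_
  rw [mul_pow, hf, hn, div_mul_eq_mul_div, le_div_iff₀ hp]
  nlinarith [mul_nonneg (sub_nonneg.2 hr) (sq_nonneg (1 - ‖c‖ * y))]

/-- The integral `∫₀^∞ log (1 + s³ x³) / (x² - x + 1) dx`. -/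
noncomputable def logIntegral (s : ℂ) : ℂ :=
  ∫ x in Set.Ioi (0 : ℝ), kernel x • Complex.log (1 + s ^ 3 * ((x ^ 3 : ℝ) : ℂ))

theorem log_one_add_mul_cube_le {r x : ℝ} (hr : 0 ≤ r) (hx : 0 < x) :
    Real.log (1 + r * x ^ 3) ≤ (Real.log (1 + r) + 6) * (x + 1) ^ (1 / 2 : ℝ) := by
  have h1 : 1 + r * x ^ 3 ≤ (1 + r) * (x + 1) ^ 3 := by
    have : x ^ 3 ≤ (x + 1) ^ 3 := by gcongr; linarith
    have : (1 : ℝ) ≤ (x + 1) ^ 3 := one_le_pow₀ (by linarith)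
    nlinarith
  have h2 : Real.log (x + 1) ≤ (x + 1) ^ (1 / 2 : ℝ) / (1 / 2) :=
    Real.log_le_rpow_div (by positivity) (by norm_num)
  have h3 : (1 : ℝ) ≤ (x + 1) ^ (1 / 2 : ℝ) := Real.one_le_rpow (by linarith) (by norm_num)
  have h4 : 0 ≤ Real.log (1 + r) := Real.log_nonneg (by linarith)
  calc Real.log (1 + r * x ^ 3) ≤ Real.log ((1 + r) * (x + 1) ^ 3) :=
        Real.log_le_log (by positivity) h1
    _ = Real.log (1 + r) + 3 * Real.log (x + 1) := by
        rw [Real.log_mul (by positivity) (by positivity), Real.log_pow]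
        norm_num
    _ ≤ _ := by nlinarith

/-- The logarithm grows more slowly than `√(x + 1)`, and the kernel decays like `(x + 1)⁻²`. -/
theorem integrableOn_kernel_log {c : ℂ} (hc : c ∈ Complex.slitPlane) :
    MeasureTheory.IntegrableOn
      (fun x : ℝ => kernel x • Complex.log (1 + c * ((x ^ 3 : ℝ) : ℂ))) (Set.Ioi 0) := by
  have hslit : ∀ x : ℝ, 0 < x → 1 + c * ((x ^ 3 : ℝ) : ℂ) ∈ Complex.slitPlane := fun x hx =>
    one_add_mul_mem_slitPlane hc (by positivity)
  refine integrableOn_kernel_smul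
    (C := (Real.log (1 + ‖c‖) + 6) + (|Real.log (slitFactor c)| + Real.pi)) ?_ fun x hx => ?_
  · exact ContinuousOn.clog (by fun_prop) hslit
  · set z : ℂ := 1 + c * ((x ^ 3 : ℝ) : ℂ) with hz
    have hz0 : 0 < ‖z‖ := norm_pos_iff.2 (Complex.slitPlane_ne_zero (hslit x hx))
    have hlow := one_add_norm_mul_le hc (y := x ^ 3) (by positivity)
    rw [← hz] at hlow
    have hone : 1 ≤ 1 + ‖c‖ * x ^ 3 := by
      have : 0 ≤ ‖c‖ * x ^ 3 := by positivity
      linarith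
    have hf : 0 < slitFactor c := by
      by_contra hcon
      nlinarith [mul_nonneg (not_lt.1 hcon |> neg_nonneg.2) hz0.le]
    have hupper : ‖z‖ ≤ 1 + ‖c‖ * x ^ 3 := by
      refine (norm_add_le _ _).trans ?_
      rw [norm_one, norm_mul, Complex.norm_real, Real.norm_eq_abs, abs_of_pos (by positivity)]
    have h1 : Real.log ‖z‖ ≤ Real.log (1 + ‖c‖ * x ^ 3) := Real.log_le_log hz0 hupper
    have h2 : 0 ≤ Real.log (slitFactor c) + Real.log ‖z‖ := by
      rw [← Real.log_mul hf.ne' hz0.ne']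
      exact Real.log_nonneg (hone.trans hlow)
    have h3 := log_one_add_mul_cube_le (norm_nonneg c) hx
    have h4 : 0 ≤ Real.log (1 + ‖c‖ * x ^ 3) := Real.log_nonneg hone
    have habs : |Real.log ‖z‖| ≤ Real.log (1 + ‖c‖ * x ^ 3) + |Real.log (slitFactor c)| := by
      rw [abs_le]
      constructor <;> linarith [le_abs_self (Real.log (slitFactor c)),
        abs_nonneg (Real.log (slitFactor c))]
    have h5 : (1 : ℝ) ≤ (x + 1) ^ (1 / 2 : ℝ) := Real.one_le_rpow (by linarith) (by norm_num)
    have h6 : 0 ≤ |Real.log (slitFactor c)| + Real.pi := by positivity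
    calc ‖Complex.log z‖ ≤ |(Complex.log z).re| + |(Complex.log z).im| :=
          Complex.norm_le_abs_re_add_abs_im _
      _ ≤ (Real.log (1 + ‖c‖ * x ^ 3) + |Real.log (slitFactor c)|) + Real.pi := by
          rw [Complex.log_re, Complex.log_im]
          exact add_le_add habs (Complex.abs_arg_le_pi z)
      _ ≤ _ := by nlinarith

theorem continuousAt_slitFactor {c : ℂ} (hc : c ∈ Complex.slitPlane) :
    ContinuousAt slitFactor c := by
  have := (norm_add_re_pos hc).ne'
  unfold slitFactor
  fun_prop (disch := assumption)

/-- Differentiation under the integral sign; near `s` the derivative of the logarithm is bounded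
uniformly in `x` because `slitFactor` is continuous. -/
theorem hasDerivAt_logIntegral {s : ℂ} (hs : s ∈ cubeSector) :
    HasDerivAt logIntegral (∫ x in Set.Ioi (0 : ℝ), kernel x •
      (3 * s ^ 2 * ((x ^ 3 : ℝ) : ℂ) / (1 + s ^ 3 * ((x ^ 3 : ℝ) : ℂ)))) s := by
  have hne : ∀ {z : ℂ}, z ∈ cubeSector → z ≠ 0 := fun hz h => by
    have := re_pos_of_mem_cubeSector hz
    simp [h] at this
  have hslit : ∀ {z : ℂ} {x : ℝ}, z ∈ cubeSector → 0 < x →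
      1 + z ^ 3 * ((x ^ 3 : ℝ) : ℂ) ∈ Complex.slitPlane := fun hz hx =>
    one_add_mul_mem_slitPlane (cube_mem_slitPlane hz) (by positivity)
  have hbound : ∀ {z : ℂ} {x : ℝ}, z ∈ cubeSector → 0 < x →
      ‖3 * z ^ 2 * ((x ^ 3 : ℝ) : ℂ) / (1 + z ^ 3 * ((x ^ 3 : ℝ) : ℂ))‖ ≤
        3 / ‖z‖ * slitFactor (z ^ 3) := by
    intro z x hz hx
    have hz0 : 0 < ‖z‖ := norm_pos_iff.2 (hne hz)
    have hd : 0 < ‖1 + z ^ 3 * ((x ^ 3 : ℝ) : ℂ)‖ :=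
      norm_pos_iff.2 (Complex.slitPlane_ne_zero (hslit hz hx))
    have hlow := one_add_norm_mul_le (cube_mem_slitPlane hz) (y := x ^ 3) (by positivity)
    rw [norm_pow] at hlow
    rw [norm_div, norm_mul, norm_mul, norm_pow, Complex.norm_real, Real.norm_eq_abs,
      abs_of_pos (by positivity : 0 < x ^ 3), div_le_iff₀ hd]
    have h3 : ‖(3 : ℂ)‖ = 3 := by simp
    rw [h3, mul_assoc (3 / ‖z‖)]
    calc 3 * ‖z‖ ^ 2 * x ^ 3 = 3 / ‖z‖ * (‖z‖ ^ 3 * x ^ 3) := by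
          field_simp
      _ ≤ _ := mul_le_mul_of_nonneg_left (by linarith) (by positivity)
  have hcont : ContinuousAt (fun z : ℂ => 3 / ‖z‖ * slitFactor (z ^ 3)) s := by
    have h1 : ContinuousAt (fun z : ℂ => slitFactor (z ^ 3)) s :=
      ContinuousAt.comp' (continuousAt_slitFactor (cube_mem_slitPlane hs)) (by fun_prop)
    have h2 : ‖s‖ ≠ 0 := norm_ne_zero_iff.2 (hne hs)
    exact (continuousAt_const.div continuous_norm.continuousAt h2).mul h1
  have hnhds : {z : ℂ | z ∈ cubeSector ∧
      3 / ‖z‖ * slitFactor (z ^ 3) < 3 / ‖s‖ * slitFactor (s ^ 3) + 1} ∈ nhds s :=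
    Filter.inter_mem (isOpen_cubeSector.mem_nhds hs)
      (hcont.eventually_lt_const (by linarith))
  refine (hasDerivAt_integral_of_dominated_loc_of_deriv_le
    (F := fun (z : ℂ) (x : ℝ) => kernel x • Complex.log (1 + z ^ 3 * ((x ^ 3 : ℝ) : ℂ)))
    (F' := fun (z : ℂ) (x : ℝ) => kernel x •
      (3 * z ^ 2 * ((x ^ 3 : ℝ) : ℂ) / (1 + z ^ 3 * ((x ^ 3 : ℝ) : ℂ))))
    (bound := fun x => kernel x • (3 / ‖s‖ * slitFactor (s ^ 3) + 1))
    hnhds ?_ (integrableOn_kernel_log (cube_mem_slitPlane hs)) ?_ ?_ ?_ ?_).2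
  · filter_upwards [isOpen_cubeSector.mem_nhds hs] with z hz
    exact (integrableOn_kernel_log (cube_mem_slitPlane hz)).aestronglyMeasurable
  · refine ((continuous_kernel.continuousOn.smul (ContinuousOn.div (by fun_prop) (by fun_prop)
      fun x hx => ?_)).aestronglyMeasurable measurableSet_Ioi)
    exact Complex.slitPlane_ne_zero (hslit hs hx)
  · filter_upwards [MeasureTheory.ae_restrict_mem measurableSet_Ioi] with x hx z hz
    rw [norm_smul, Real.norm_eq_abs, abs_of_pos (kernel_pos x), smul_eq_mul]
    exact mul_le_mul_of_nonneg_left ((hbound hz.1 hx).trans hz.2.le) (kernel_pos x).le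
  · exact integrableOn_kernel_smul_of_bounded continuousOn_const fun x _ => le_rfl
  · filter_upwards [MeasureTheory.ae_restrict_mem measurableSet_Ioi] with x hx z hz
    have h1 : HasDerivAt (fun z : ℂ => 1 + z ^ 3 * ((x ^ 3 : ℝ) : ℂ))
        (3 * z ^ 2 * ((x ^ 3 : ℝ) : ℂ)) z := by
      simpa [-Complex.ofReal_pow] using
        ((hasDerivAt_pow 3 z).mul_const ((x ^ 3 : ℝ) : ℂ)).const_add 1
    exact (h1.clog (hslit hz.1 hx)).const_smul (kernel x)

/-! ### The closed form on the sector -/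

theorem hasDerivAt_const_mul_log_one_add_add_sq (K : ℂ) {s : ℂ} (hs : 0 < s.re) :
    HasDerivAt (fun z : ℂ => K * Complex.log (1 + z + z ^ 2))
      (K * ((1 + 2 * s) / (1 + s + s ^ 2))) s := by
  have h1 : HasDerivAt (fun z : ℂ => 1 + z + z ^ 2) (1 + 2 * s) s := by
    simpa using! ((hasDerivAt_id s).const_add 1).add (hasDerivAt_pow 2 s)
  exact (h1.clog (one_add_add_sq_mem_slitPlane hs)).const_mul K

theorem continuousOn_logIntegral_ofReal :
    ContinuousOn (fun t : ℝ => logIntegral t) (Set.Icc 0 1) := by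
  have hpos : ∀ {t x : ℝ}, 0 ≤ t → 0 < x → 1 ≤ 1 + t ^ 3 * x ^ 3 := fun ht hx =>
    le_add_of_nonneg_right (mul_nonneg (pow_nonneg ht 3) (pow_nonneg hx.le 3))
  have hcast : ∀ t x : ℝ, (1 : ℂ) + (t : ℂ) ^ 3 * ((x ^ 3 : ℝ) : ℂ) =
      ((1 + t ^ 3 * x ^ 3 : ℝ) : ℂ) := fun t x => by push_cast; ring
  have hslit : ∀ {t x : ℝ}, 0 ≤ t → 0 < x →
      (1 : ℂ) + (t : ℂ) ^ 3 * ((x ^ 3 : ℝ) : ℂ) ∈ Complex.slitPlane := fun ht hx => by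
    rw [hcast, Complex.ofReal_mem_slitPlane]
    linarith [hpos ht hx]
  refine MeasureTheory.continuousOn_of_dominated
    (F := fun (t : ℝ) (x : ℝ) =>
      kernel x • Complex.log (1 + (t : ℂ) ^ 3 * ((x ^ 3 : ℝ) : ℂ)))
    (bound := fun x => kernel x • Real.log (1 + 1 * x ^ 3)) (fun t ht => ?_) (fun t ht => ?_)
    ?_ ?_
  · exact (continuous_kernel.continuousOn.smul (ContinuousOn.clog (by fun_prop)
      fun x hx => hslit ht.1 hx)).aestronglyMeasurable measurableSet_Ioi
  · filter_upwards [MeasureTheory.ae_restrict_mem measurableSet_Ioi] with x hx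
    have h1 := hpos ht.1 hx
    have hx : 0 < x := hx
    rw [norm_smul, Real.norm_eq_abs, abs_of_pos (kernel_pos x), smul_eq_mul, hcast,
      ← Complex.ofReal_log (by linarith), Complex.norm_real, Real.norm_eq_abs,
      abs_of_nonneg (Real.log_nonneg h1)]
    have ht3 : t ^ 3 ≤ 1 := pow_le_one₀ ht.1 ht.2
    refine mul_le_mul_of_nonneg_left (Real.log_le_log (by linarith) ?_) (kernel_pos x).le
    gcongr
  · refine integrableOn_kernel_smul (C := Real.log (1 + 1) + 6) ?_ fun x hx => ?_
    · refine ContinuousOn.log (by fun_prop) fun x hx => ?_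
      have hx : 0 < x := hx
      positivity
    · have hx3 : 0 < x ^ 3 := by positivity
      rw [Real.norm_eq_abs, abs_of_nonneg (Real.log_nonneg (by linarith))]
      exact log_one_add_mul_cube_le zero_le_one hx
  · filter_upwards [MeasureTheory.ae_restrict_mem measurableSet_Ioi] with x hx
    exact (ContinuousOn.clog (by fun_prop) fun t (ht : t ∈ Set.Icc (0 : ℝ) 1) =>
      hslit ht.1 hx).const_smul (kernel x)

/-- On the positive real axis both sides have the same derivative, and both vanish at `0`. -/
theorem logIntegral_ofReal {t : ℝ} (h0 : 0 < t) (h1 : t < 1) :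
    logIntegral t =
      ((2 * Real.pi * √3 / 3 : ℝ) : ℂ) * Complex.log (1 + (t : ℂ) + (t : ℂ) ^ 2) := by
  set K : ℂ := ((2 * Real.pi * √3 / 3 : ℝ) : ℂ) with hK
  have hder : ∀ u ∈ Set.Ioo 0 t, HasDerivAt
      (fun u : ℝ => logIntegral u - K * Complex.log (1 + (u : ℂ) + (u : ℂ) ^ 2)) 0 u := by
    intro u hu
    have hint : ∫ x in Set.Ioi (0 : ℝ), kernel x •
        (3 * (u : ℂ) ^ 2 * ((x ^ 3 : ℝ) : ℂ) / (1 + (u : ℂ) ^ 3 * ((x ^ 3 : ℝ) : ℂ))) =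
        K * ((1 + 2 * (u : ℂ)) / (1 + u + (u : ℂ) ^ 2)) := by
      have h := integral_kernel_mul_cube_div hu.1 (hu.2.trans h1)
      have hc : ∀ x : ℝ, kernel x •
          (3 * (u : ℂ) ^ 2 * ((x ^ 3 : ℝ) : ℂ) / (1 + (u : ℂ) ^ 3 * ((x ^ 3 : ℝ) : ℂ))) =
          ((kernel x * (3 * u ^ 2 * x ^ 3 / (1 + u ^ 3 * x ^ 3)) : ℝ) : ℂ) := fun x => by
        rw [Complex.real_smul]
        push_cast
        ring
      simp_rw [hc]
      rw [integral_complex_ofReal, h, hK]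
      push_cast
      ring
    have hd := (hasDerivAt_logIntegral (ofReal_mem_cubeSector hu.1)).sub
      (hasDerivAt_const_mul_log_one_add_add_sq K (s := (u : ℂ)) (by simpa using hu.1))
    rw [hint, sub_self] at hd
    exact hd.comp_ofReal
  have hcont : ContinuousOn
      (fun u : ℝ => logIntegral u - K * Complex.log (1 + (u : ℂ) + (u : ℂ) ^ 2))
      (Set.Icc 0 t) := by
    refine (continuousOn_logIntegral_ofReal.mono (Set.Icc_subset_Icc_right h1.le)).sub
      (continuousOn_const.mul (ContinuousOn.clog (by fun_prop) fun u hu => ?_))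
    rw [show (1 : ℂ) + u + (u : ℂ) ^ 2 = ((1 + u + u ^ 2 : ℝ) : ℂ) by push_cast; ring,
      Complex.ofReal_mem_slitPlane]
    nlinarith [hu.1]
  have h := intervalIntegral.integral_eq_sub_of_hasDerivAt_of_le h0.le hcont hder
    intervalIntegrable_const
  have hz : logIntegral ((0 : ℝ) : ℂ) = 0 := by simp [logIntegral]
  rw [intervalIntegral.integral_zero, hz] at h
  simp only [Complex.ofReal_zero, add_zero, ne_eq, OfNat.ofNat_ne_zero, not_false_eq_true,
    zero_pow, Complex.log_one, mul_zero, sub_zero] at h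
  exact sub_eq_zero.1 h.symm

/-- The identity on the segment `(0, 1)` continues analytically to the whole sector. -/
theorem logIntegral_eq {s : ℂ} (hs : s ∈ cubeSector) :
    logIntegral s = ((2 * Real.pi * √3 / 3 : ℝ) : ℂ) * Complex.log (1 + s + s ^ 2) := by
  have hA : AnalyticOnNhd ℂ logIntegral cubeSector := DifferentiableOn.analyticOnNhd
    (fun z hz => (hasDerivAt_logIntegral hz).differentiableAt.differentiableWithinAt)
    isOpen_cubeSector
  have hB : AnalyticOnNhd ℂ
      (fun z : ℂ => ((2 * Real.pi * √3 / 3 : ℝ) : ℂ) * Complex.log (1 + z + z ^ 2))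
      cubeSector := DifferentiableOn.analyticOnNhd
    (fun z hz => (hasDerivAt_const_mul_log_one_add_add_sq _
      (re_pos_of_mem_cubeSector hz)).differentiableAt.differentiableWithinAt)
    isOpen_cubeSector
  refine hA.eqOn_of_preconnected_of_frequently_eq hB convex_cubeSector.isPreconnected
    (ofReal_mem_cubeSector (t := 1 / 2) (by norm_num)) ?_ hs
  have htend : Filter.Tendsto (fun t : ℝ => (t : ℂ)) (nhdsWithin (1 / 2) {1 / 2}ᶜ)
      (nhdsWithin ((1 / 2 : ℝ) : ℂ) {((1 / 2 : ℝ) : ℂ)}ᶜ) := by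
    refine Complex.continuous_ofReal.continuousWithinAt.tendsto_nhdsWithin fun t ht => ?_
    simpa only [Set.mem_compl_iff, Set.mem_singleton_iff, Complex.ofReal_inj] using ht
  refine htend.frequently (Filter.Eventually.frequently ?_)
  have h0 : ∀ᶠ t : ℝ in nhds (1 / 2), 0 < t := lt_mem_nhds (by norm_num)
  have h1 : ∀ᶠ t : ℝ in nhds (1 / 2), t < 1 := gt_mem_nhds (by norm_num)
  filter_upwards [nhdsWithin_le_nhds h0, nhdsWithin_le_nhds h1] with t ht0 ht1
  exact logIntegral_ofReal ht0 ht1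

/-- Twice the real part of the closed form at `s = exp (i γ / 3)`, where
`|1 + s³ x³|² = x⁶ + 2 x³ cos γ + 1` and `|1 + s + s²| = 1 + 2 cos (γ / 3)`. -/
theorem integral_kernel_mul_log_quadratic {γ : ℝ} (hγ : |γ| < Real.pi) :
    MeasureTheory.IntegrableOn
      (fun x : ℝ => kernel x * Real.log (x ^ 6 + 2 * x ^ 3 * Real.cos γ + 1)) (Set.Ioi 0) ∧
    ∫ x in Set.Ioi (0 : ℝ), kernel x * Real.log (x ^ 6 + 2 * x ^ 3 * Real.cos γ + 1) =
      4 * Real.pi * √3 / 3 * Real.log (1 + 2 * Real.cos (γ / 3)) := by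
  set s : ℂ := Complex.exp ((γ / 3 : ℝ) * Complex.I) with hsdef
  have hre : s.re = Real.cos (γ / 3) := Complex.exp_ofReal_mul_I_re _
  have him : s.im = Real.sin (γ / 3) := Complex.exp_ofReal_mul_I_im _
  rw [abs_lt] at hγ
  have hcos : 0 < Real.cos (γ / 3) :=
    Real.cos_pos_of_mem_Ioo ⟨by linarith [Real.pi_pos], by linarith [Real.pi_pos]⟩
  have hs : s ∈ cubeSector := by
    change |s.im| < √3 * s.re
    rw [hre, him, ← sub_pos]
    have h3 : (√3 : ℝ) = 2 * Real.sin (Real.pi / 3) := by rw [Real.sin_pi_div_three]; ring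
    have hhalf : (1 : ℝ) = 2 * Real.cos (Real.pi / 3) := by rw [Real.cos_pi_div_three]; ring
    have hp : 0 < Real.sin (Real.pi / 3 - γ / 3) :=
      Real.sin_pos_of_pos_of_lt_pi (by linarith) (by linarith [Real.pi_pos])
    have hm : 0 < Real.sin (Real.pi / 3 + γ / 3) :=
      Real.sin_pos_of_pos_of_lt_pi (by linarith) (by linarith [Real.pi_pos])
    rw [Real.sin_sub] at hp
    rw [Real.sin_add] at hm
    rcases abs_cases (Real.sin (γ / 3)) with h | h <;> rw [h.1, h3] <;> nlinarith
  have hs3 : s ^ 3 = Complex.exp (γ * Complex.I) := by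
    rw [hsdef, ← Complex.exp_nat_mul]
    congr 1
    push_cast
    ring
  have hnorm : ∀ x : ℝ, Real.log (x ^ 6 + 2 * x ^ 3 * Real.cos γ + 1) =
      2 * Real.log ‖1 + s ^ 3 * ((x ^ 3 : ℝ) : ℂ)‖ := by
    intro x
    have h : ‖1 + s ^ 3 * ((x ^ 3 : ℝ) : ℂ)‖ ^ 2 = x ^ 6 + 2 * x ^ 3 * Real.cos γ + 1 := by
      rw [← Complex.normSq_eq_norm_sq, Complex.normSq_apply, hs3]
      simp only [Complex.add_re, Complex.add_im, Complex.one_re, Complex.one_im,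
        Complex.re_mul_ofReal, Complex.im_mul_ofReal, Complex.exp_ofReal_mul_I_re,
        Complex.exp_ofReal_mul_I_im]
      linear_combination x ^ 6 * Real.sin_sq_add_cos_sq γ
    rw [← h, Real.log_pow]
    norm_num
  have hfun : ∀ x : ℝ, kernel x * Real.log (x ^ 6 + 2 * x ^ 3 * Real.cos γ + 1) =
      2 * (kernel x • Complex.log (1 + s ^ 3 * ((x ^ 3 : ℝ) : ℂ))).re := by
    intro x
    rw [hnorm, Complex.smul_re, Complex.log_re, smul_eq_mul]
    ring
  have hint := integrableOn_kernel_log (cube_mem_slitPlane hs)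
  simp_rw [hfun]
  refine ⟨hint.re.const_mul 2, ?_⟩
  have hnorm2 : ‖1 + s + s ^ 2‖ = 1 + 2 * Real.cos (γ / 3) := by
    have h : (1 + s + s ^ 2 : ℂ) = s * ((1 + 2 * Real.cos (γ / 3) : ℝ) : ℂ) := by
      apply Complex.ext
      · simp only [pow_two, Complex.add_re, Complex.one_re, Complex.mul_re, Complex.ofReal_re,
          Complex.ofReal_im, hre, him]
        linear_combination -Real.sin_sq_add_cos_sq (γ / 3)
      · simp only [pow_two, Complex.add_im, Complex.one_im, Complex.mul_im, Complex.ofReal_re,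
          Complex.ofReal_im, hre, him]
        ring
    rw [h, norm_mul, Complex.norm_real, Real.norm_eq_abs, abs_of_pos (by positivity), hsdef,
      Complex.norm_exp_ofReal_mul_I, one_mul]
  have hre2 := integral_re hint
  have hE := logIntegral_eq hs
  rw [MeasureTheory.integral_const_mul]
  change _ = (logIntegral s).re at hre2
  rw [hE, Complex.re_ofReal_mul, Complex.log_re, hnorm2] at hre2
  change 2 * (∫ x in Set.Ioi (0 : ℝ),
    RCLike.re (kernel x • Complex.log (1 + s ^ 3 * ((x ^ 3 : ℝ) : ℂ)))) = _
  rw [hre2]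
  ring

/-! ### Folding the half-line onto the unit interval -/

theorem integral_Ioi_one_inversion (h : ℝ → ℝ) :
    ∫ x in Set.Ioi (1 : ℝ), h x = ∫ x in Set.Ioo (0 : ℝ) 1, (x ^ 2)⁻¹ * h x⁻¹ := by
  have h1 : ∫ x in Set.Ioi (1 : ℝ), h x =
      ∫ x in Set.Ioi (0 : ℝ), (Set.Ioi (1 : ℝ)).indicator h x := by
    rw [MeasureTheory.setIntegral_indicator measurableSet_Ioi,
      Set.inter_eq_self_of_subset_right (Set.Ioi_subset_Ioi zero_le_one)]
  have h2 : ∫ x in Set.Ioo (0 : ℝ) 1, (x ^ 2)⁻¹ * h x⁻¹ =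
      ∫ x in Set.Ioi (0 : ℝ), (Set.Iio (1 : ℝ)).indicator (fun x => (x ^ 2)⁻¹ * h x⁻¹) x := by
    rw [MeasureTheory.setIntegral_indicator measurableSet_Iio, Set.Ioi_inter_Iio]
  rw [h1, h2, ← integral_Ioi_inversion]
  refine MeasureTheory.setIntegral_congr_fun measurableSet_Ioi fun x hx => ?_
  have hx : 0 < x := hx
  by_cases hx1 : x < 1
  · have : 1 < x⁻¹ := (one_lt_inv₀ hx).2 hx1
    simp [Set.indicator_of_mem (Set.mem_Ioi.2 this), Set.indicator_of_mem (Set.mem_Iio.2 hx1)]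
  · have : ¬ 1 < x⁻¹ := fun hc => hx1 ((one_lt_inv₀ hx).1 hc)
    simp [Set.indicator_of_notMem (mt Set.mem_Ioi.1 this),
      Set.indicator_of_notMem (mt Set.mem_Iio.1 hx1)]

theorem integral_kernel_log_pow_fold (n : ℕ)
    (hint : MeasureTheory.IntegrableOn (fun x => kernel x * Real.log (x ^ n + 1))
      (Set.Ioi 0)) :
    ∫ x in Set.Ioi (0 : ℝ), kernel x * Real.log (x ^ n + 1) =
      2 * (∫ x in (0 : ℝ)..1, kernel x * Real.log (x ^ n + 1)) -
        n * ∫ x in (0 : ℝ)..1, kernel x * Real.log x := by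
  have hi1 : IntervalIntegrable (fun x => kernel x * Real.log (x ^ n + 1))
      MeasureTheory.volume 0 1 :=
    (intervalIntegrable_iff_integrableOn_Ioc_of_le zero_le_one).2
      (hint.mono_set Set.Ioc_subset_Ioi_self)
  have hi2 : IntervalIntegrable (fun x => kernel x * Real.log x) MeasureTheory.volume 0 1 :=
    intervalIntegrable_mul_log continuous_kernel 0 1
  have hout : ∫ x in Set.Ioi (1 : ℝ), kernel x * Real.log (x ^ n + 1) =
      (∫ x in (0 : ℝ)..1, kernel x * Real.log (x ^ n + 1)) -
        n * ∫ x in (0 : ℝ)..1, kernel x * Real.log x := by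
    rw [integral_Ioi_one_inversion, ← intervalIntegral.integral_const_mul,
      ← intervalIntegral.integral_sub hi1 (hi2.const_mul _),
      intervalIntegral.integral_of_le zero_le_one, MeasureTheory.integral_Ioc_eq_integral_Ioo]
    refine MeasureTheory.setIntegral_congr_fun measurableSet_Ioo fun x hx => ?_
    have hx0 : 0 < x := hx.1
    have hlog : Real.log (x⁻¹ ^ n + 1) = Real.log (x ^ n + 1) - n * Real.log x := by
      rw [← Real.log_pow, ← Real.log_div (by positivity) (by positivity), inv_pow]
      congr 1
      field_simp
      ring
    rw [← mul_assoc, inv_sq_mul_kernel_inv hx0, hlog]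
    ring
  rw [← Set.Ioc_union_Ioi_eq_Ioi zero_le_one,
    MeasureTheory.setIntegral_union Set.Ioc_disjoint_Ioi_same measurableSet_Ioi
      (hint.mono_set Set.Ioc_subset_Ioi_self)
      (hint.mono_set (Set.Ioi_subset_Ioi zero_le_one)),
    hout, ← intervalIntegral.integral_of_le zero_le_one]
  ring

/-! ### The factorization of `yᵐ + 1` -/

/-- The roots of `yᵐ + 1` are `exp (i (2 j + 1) π / m)`; take squared absolute values. -/
theorem sq_pow_add_one_eq_prod {m : ℕ} (hm : 1 ≤ m) (y : ℝ) :
    (y ^ m + 1) ^ 2 = ∏ j ∈ Finset.range m, (y ^ 2 - 2 * y * varphi m j + 1) := by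
  have hm0 : (m : ℂ) ≠ 0 := by
    norm_cast
    omega
  have hα : Complex.exp (Real.pi * Complex.I / m) ^ m = -1 := by
    rw [← Complex.exp_nat_mul, mul_div_cancel₀ _ hm0, Complex.exp_pi_mul_I]
  have h := congrArg (Polynomial.eval (y : ℂ))
    (X_pow_sub_C_eq_prod (Complex.isPrimitiveRoot_exp m (by omega)) hm hα)
  rw [Polynomial.eval_prod] at h
  simp only [Polynomial.eval_sub, Polynomial.eval_pow, Polynomial.eval_X,
    Polynomial.eval_C, sub_neg_eq_add] at h
  have h2 := congrArg Complex.normSq h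
  rw [map_prod, show (y : ℂ) ^ m + 1 = ((y ^ m + 1 : ℝ) : ℂ) by push_cast; ring,
    Complex.normSq_ofReal, ← pow_two] at h2
  rw [h2]
  refine Finset.prod_congr rfl fun j _ => ?_
  have hroot : Complex.exp (2 * Real.pi * Complex.I / m) ^ j *
      Complex.exp (Real.pi * Complex.I / m) =
      Complex.exp (((2 * (j : ℝ) + 1) * Real.pi / m : ℝ) * Complex.I) := by
    rw [← Complex.exp_nat_mul, ← Complex.exp_add]
    congr 1
    push_cast
    field_simp
  rw [hroot, Complex.normSq_apply, varphi]
  simp only [Complex.sub_re, Complex.sub_im, Complex.ofReal_re, Complex.ofReal_im,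
    Complex.exp_ofReal_mul_I_re, Complex.exp_ofReal_mul_I_im]
  linear_combination Real.sin_sq_add_cos_sq ((2 * (j : ℝ) + 1) * Real.pi / m)

theorem sum_range_two_mul_of_symm {a : ℕ → ℝ} {n : ℕ}
    (h : ∀ j < 2 * n, a (2 * n - 1 - j) = a j) :
    ∑ j ∈ Finset.range (2 * n), a j = 2 * ∑ j ∈ Finset.range n, a j := by
  rw [two_mul n, Finset.sum_range_add, two_mul]
  congr 1
  rw [← Finset.sum_range_reflect a n]
  refine Finset.sum_congr rfl fun j hj => ?_
  have hj := Finset.mem_range.1 hj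
  rw [← h (n + j) (by omega)]
  congr 1
  omega

theorem sum_range_two_mul_add_one_of_symm {a : ℕ → ℝ} {n : ℕ}
    (h : ∀ j < 2 * n + 1, a (2 * n - j) = a j) :
    ∑ j ∈ Finset.range (2 * n + 1), a j = 2 * (∑ j ∈ Finset.range n, a j) + a n := by
  rw [show 2 * n + 1 = n + (1 + n) by ring, Finset.sum_range_add, Finset.sum_range_add,
    Finset.sum_range_one, two_mul, ← Finset.sum_range_reflect a n, add_zero]
  have : ∑ j ∈ Finset.range n, a (n + (1 + j)) = ∑ j ∈ Finset.range n, a (n - 1 - j) := by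
    refine Finset.sum_congr rfl fun j hj => ?_
    have hj := Finset.mem_range.1 hj
    rw [← h (n + (1 + j)) (by omega)]
    congr 1
    omega
  rw [this]
  ring

/-! ### The closed form of the integral -/

/-- The angle `γⱼ = π - (2 j + 1) π / m`, for which `cos γⱼ = -φⱼ`. -/
noncomputable def rootAngle (m j : ℕ) : ℝ := Real.pi - (2 * (j : ℝ) + 1) * Real.pi / m

theorem cos_rootAngle (m j : ℕ) : Real.cos (rootAngle m j) = -varphi m j := by
  rw [rootAngle, Real.cos_pi_sub, varphi]

theorem rootAngle_eq {m : ℕ} (hm : 1 ≤ m) (j : ℕ) :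
    rootAngle m j = Real.pi * ((m - 1 - 2 * j) / m) := by
  have : (0 : ℝ) < m := by exact_mod_cast hm
  rw [rootAngle]
  field_simp
  ring

theorem abs_rootAngle_lt {m j : ℕ} (hj : j < m) : |rootAngle m j| < Real.pi := by
  have hm : (0 : ℝ) < m := by exact_mod_cast (Nat.zero_le j).trans_lt hj
  have hj' : (j : ℝ) + 1 ≤ m := by exact_mod_cast hj
  have hj0 : (0 : ℝ) ≤ j := Nat.cast_nonneg j
  rw [rootAngle_eq (by omega), abs_mul, abs_of_pos Real.pi_pos]
  refine mul_lt_of_lt_one_right Real.pi_pos ?_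
  rw [abs_lt, lt_div_iff₀ hm, div_lt_one hm]
  constructor <;> linarith

theorem rootAngle_reflect {m j : ℕ} (hj : j < m) :
    rootAngle m (m - 1 - j) = -rootAngle m j := by
  rw [rootAngle_eq (by omega), rootAngle_eq (by omega), Nat.cast_sub (by omega),
    Nat.cast_sub (by omega)]
  push_cast
  ring

theorem integral_kernel_log_pow_add_one {m : ℕ} (hm : 1 ≤ m) :
    MeasureTheory.IntegrableOn (fun x => kernel x * Real.log (x ^ (3 * m) + 1))
      (Set.Ioi 0) ∧
    ∫ x in Set.Ioi (0 : ℝ), kernel x * Real.log (x ^ (3 * m) + 1) =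
      2 * Real.pi * √3 / 3 *
        ∑ j ∈ Finset.range m, Real.log (1 + 2 * Real.cos (rootAngle m j / 3)) := by
  have hsum : Set.EqOn (fun x => 1 / 2 * ∑ j ∈ Finset.range m,
      kernel x * Real.log (x ^ 6 + 2 * x ^ 3 * Real.cos (rootAngle m j) + 1))
      (fun x => kernel x * Real.log (x ^ (3 * m) + 1)) (Set.Ioi 0) := by
    intro x hx
    have hx : 0 < x := hx
    have hfac := sq_pow_add_one_eq_prod hm (x ^ 3)
    have hne : ∀ j ∈ Finset.range m, (x ^ 3) ^ 2 - 2 * x ^ 3 * varphi m j + 1 ≠ 0 := by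
      refine Finset.prod_ne_zero_iff.1 ?_
      rw [← hfac]
      positivity
    have hlog := congrArg Real.log hfac
    rw [Real.log_prod hne, Real.log_pow, ← pow_mul] at hlog
    have hterm : ∀ j, x ^ 6 + 2 * x ^ 3 * Real.cos (rootAngle m j) + 1 =
        (x ^ 3) ^ 2 - 2 * x ^ 3 * varphi m j + 1 := fun j => by
      rw [cos_rootAngle]
      ring
    simp only [hterm]
    rw [← Finset.mul_sum, ← hlog]
    push_cast
    ring
  have hj : ∀ j ∈ Finset.range m, _ := fun j hj =>
    integral_kernel_mul_log_quadratic (abs_rootAngle_lt (Finset.mem_range.1 hj))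
  refine ⟨MeasureTheory.IntegrableOn.congr_fun
    ((MeasureTheory.integrable_finsetSum _ fun j h => (hj j h).1).const_mul (1 / 2)) hsum
    measurableSet_Ioi, ?_⟩
  rw [← MeasureTheory.setIntegral_congr_fun measurableSet_Ioi hsum,
    MeasureTheory.integral_const_mul,
    MeasureTheory.integral_finsetSum _ fun j h => (hj j h).1,
    Finset.sum_congr rfl fun j h => (hj j h).2, ← Finset.mul_sum]
  ring

/-- The closed form before the sum over `j < m` is folded in half; it holds for both parities. -/
theorem integral_unit_eq_sum {m : ℕ} (hm : 1 ≤ m) :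
    ∫ x in (0 : ℝ)..1, (x + 1) * Real.log (x ^ (3 * m) + 1) / (x ^ 3 + 1) =
      (m : ℝ) / 12 * (deriv psi (5 / 6) - deriv psi (1 / 3)) - Real.pi ^ 2 * m / 9 +
        Real.pi * √3 / 3 *
          ∑ j ∈ Finset.range m, Real.log (1 + 2 * Real.cos (rootAngle m j / 3)) := by
  have hcongr : ∫ x in (0 : ℝ)..1, (x + 1) * Real.log (x ^ (3 * m) + 1) / (x ^ 3 + 1) =
      ∫ x in (0 : ℝ)..1, kernel x * Real.log (x ^ (3 * m) + 1) := by
    rw [intervalIntegral.integral_of_le zero_le_one, intervalIntegral.integral_of_le zero_le_one]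
    refine MeasureTheory.setIntegral_congr_fun measurableSet_Ioc fun x hx => ?_
    simp only [kernel_eq_div hx.1]
    ring
  obtain ⟨hint, hval⟩ := integral_kernel_log_pow_add_one hm
  have hfold := integral_kernel_log_pow_fold (3 * m) hint
  rw [hval, integral_log_kernel] at hfold
  push_cast at hfold
  rw [hcongr]
  linear_combination -(1 / 2) * hfold

/-- With `a = γ / 6` the arcsine equals `3 a`, and `sin 3a = sin a (2 cos 2a + 1)`,
`φ + 1 = 2 sin² 3a`. -/
theorem log_sin_arcsin_identity {m k : ℕ} (h : 2 * k + 1 < m) :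
    2 * Real.log (Real.sin (1 / 3 * Real.arcsin (√((varphi m k + 1) / 2))))
      - Real.log (2 * Real.cos (2 / 3 * Real.arcsin (√((1 + varphi m k) / 2))) + 1)
      - Real.log (varphi m k + 1) =
    -Real.log 2 - 3 * Real.log (1 + 2 * Real.cos (rootAngle m k / 3)) := by
  have hpos : 0 < rootAngle m k := by
    have hm : (0 : ℝ) < m := by exact_mod_cast (Nat.zero_le _).trans_lt h
    have h' : 2 * (k : ℝ) + 1 < m := by exact_mod_cast h
    rw [rootAngle_eq (by omega)]
    exact mul_pos Real.pi_pos (div_pos (by linarith) hm)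
  have hlt := (le_abs_self _).trans_lt (abs_rootAngle_lt (m := m) (j := k) (by omega))
  obtain ⟨a, ha⟩ : ∃ a, rootAngle m k = 6 * a := ⟨rootAngle m k / 6, by ring⟩
  rw [ha] at hpos hlt ⊢
  have hphi : varphi m k + 1 = 2 * Real.sin (3 * a) ^ 2 := by
    have h1 := cos_rootAngle m k
    rw [ha, show 6 * a = 2 * (3 * a) by ring, Real.cos_two_mul, Real.cos_sq'] at h1
    linarith
  have hs3 : 0 < Real.sin (3 * a) :=
    Real.sin_pos_of_pos_of_lt_pi (by linarith) (by linarith [Real.pi_pos])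
  have hs1 : 0 < Real.sin a :=
    Real.sin_pos_of_pos_of_lt_pi (by linarith) (by linarith [Real.pi_pos])
  have hc : 0 < Real.cos (2 * a) :=
    Real.cos_pos_of_mem_Ioo ⟨by linarith [Real.pi_pos], by linarith [Real.pi_pos]⟩
  have harc : Real.arcsin (√((varphi m k + 1) / 2)) = 3 * a := by
    rw [hphi, mul_div_cancel_left₀ _ two_ne_zero, Real.sqrt_sq hs3.le,
      Real.arcsin_sin (by linarith [Real.pi_pos]) (by linarith)]
  have htriple : Real.sin (3 * a) = Real.sin a * (1 + 2 * Real.cos (2 * a)) := by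
    rw [Real.sin_three_mul, Real.cos_two_mul, Real.cos_sq']
    ring
  rw [add_comm 1 (varphi m k), harc, hphi, show 1 / 3 * (3 * a) = a by ring,
    show 2 / 3 * (3 * a) = 2 * a by ring, show 6 * a / 3 = 2 * a by ring,
    Real.log_mul two_ne_zero (by positivity), Real.log_pow, htriple,
    Real.log_mul hs1.ne' (by positivity), add_comm (2 * Real.cos (2 * a)) 1]
  push_cast
  ring

theorem log_one_add_two_cos_reflect {m j : ℕ} (hj : j < m) :
    Real.log (1 + 2 * Real.cos (rootAngle m (m - 1 - j) / 3)) =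
      Real.log (1 + 2 * Real.cos (rootAngle m j / 3)) := by
  rw [rootAngle_reflect hj, neg_div, Real.cos_neg]

theorem theorem2p5 :
    (∀ m : ℕ, 2 ≤ m → Even m →
      ∫ x in (0 : ℝ)..1, (x + 1) * Real.log (x ^ (3 * m) + 1) / (x ^ 3 + 1) =
        (m : ℝ) / 12 * (deriv psi (5 / 6) - deriv psi (1 / 3)) - Real.pi ^ 2 * m / 9
        - Real.pi * m * √3 / 9 * Real.log 2
        - 2 * Real.pi * √3 / 9 *
          (2 * (∑ k ∈ Finset.range (m / 2),
              Real.log (Real.sin (1 / 3 * Real.arcsin (√((varphi m k + 1) / 2)))))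
            - (∑ k ∈ Finset.range (m / 2),
              Real.log (2 * Real.cos (2 / 3 * Real.arcsin (√((1 + varphi m k) / 2))) + 1))
            - (∑ k ∈ Finset.range (m / 2), Real.log (varphi m k + 1)))) ∧
    (∀ m : ℕ, 1 ≤ m → Odd m →
      ∫ x in (0 : ℝ)..1, (x + 1) * Real.log (x ^ (3 * m) + 1) / (x ^ 3 + 1) =
        (m : ℝ) / 12 * (deriv psi (5 / 6) - deriv psi (1 / 3)) - Real.pi ^ 2 * m / 9
        + Real.pi * √3 / 3 * Real.log 3
        - Real.pi * ((m : ℝ) - 1) * √3 / 9 * Real.log 2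
        - 2 * Real.pi * √3 / 9 *
          (2 * (∑ k ∈ Finset.range ((m - 1) / 2),
              Real.log (Real.sin (1 / 3 * Real.arcsin (√((varphi m k + 1) / 2)))))
            - (∑ k ∈ Finset.range ((m - 1) / 2),
              Real.log (2 * Real.cos (2 / 3 * Real.arcsin (√((1 + varphi m k) / 2))) + 1))
            - (∑ k ∈ Finset.range ((m - 1) / 2), Real.log (1 + varphi m k)))) := by

  refine ⟨fun m hm he => ?_, fun m hm ho => ?_⟩
  · obtain ⟨n, rfl⟩ := even_iff_two_dvd.1 he
    have hfold := sum_range_two_mul_of_symm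
      (a := fun j => Real.log (1 + 2 * Real.cos (rootAngle (2 * n) j / 3))) (n := n)
      fun j hj => log_one_add_two_cos_reflect hj
    have hid := Finset.sum_congr (s₁ := Finset.range n) rfl fun k hk =>
      log_sin_arcsin_identity (m := 2 * n) (k := k) (by have := Finset.mem_range.1 hk; omega)
    simp only [Finset.sum_sub_distrib, ← Finset.mul_sum, Finset.sum_const, Finset.card_range,
      nsmul_eq_mul] at hid
    rw [integral_unit_eq_sum (by omega), hfold, Nat.mul_div_cancel_left n two_pos, hid]
    push_cast
    ring
  · obtain ⟨n, rfl⟩ := ho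
    have hfold := sum_range_two_mul_add_one_of_symm
      (a := fun j => Real.log (1 + 2 * Real.cos (rootAngle (2 * n + 1) j / 3))) (n := n)
      fun j hj => log_one_add_two_cos_reflect hj
    -- For odd `m` the root `y = -1` is unpaired: it has angle `0` and contributes `log 3`.
    have hmid : rootAngle (2 * n + 1) n = 0 := by
      rw [rootAngle_eq (by omega)]
      push_cast
      ring
    have hid := Finset.sum_congr (s₁ := Finset.range n) rfl fun k hk =>
      log_sin_arcsin_identity (m := 2 * n + 1) (k := k)
        (by have := Finset.mem_range.1 hk; omega)
    simp only [Finset.sum_sub_distrib, ← Finset.mul_sum, Finset.sum_const, Finset.card_range,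
      nsmul_eq_mul] at hid
    rw [hmid, zero_div, Real.cos_zero, show (1 + 2 * 1 : ℝ) = 3 by norm_num] at hfold
    simp only [add_comm (1 : ℝ) (varphi _ _)] at hid ⊢
    rw [integral_unit_eq_sum (by omega), hfold,
      show (2 * n + 1 - 1) / 2 = n by omega, hid]
    push_cast
    ring
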